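/- Let $\varphi\colon A\to B$ be a homomorphism of commutative rings with $1$. Call $\varphi$ *crisp* (also known as pure, or universally injective) if for every $A$-module $P$ the map $\varphi\otimes\mathrm{id}_P\colon A\otimes_A P\to B\otimes_A P$ is injective. Let $R$ be a commutative $A$-algebra (via any ring homomorphism $A\to R$). If $\varphi$ is crisp and $R\otimes_A B$ is integral over $B$ (via $b\mapsto 1\otimes b$), i.e. every element of $R\otimes_A B$ is a root of a monic polynomial with coefficients in $B$, then $R$ is integral over $A$. -/

import Mathlib

open scoped TensorProduct

universe u v w

/-- Let `A` be a commutative ring and `M`, `N` be `A`-modules. An `A`-linear map `f : M → N` is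
*crisp* (also called pure, or universally injective) if `f ⊗ id_P : M ⊗_A P → N ⊗_A P` is injective
for every `A`-module `P`.

The test modules `P` range over the universe of `A`. This is no restriction: every `A`-module is
the directed union of its finitely generated submodules, and these are, up to isomorphism, in the
universe of `A`. That a crisp map stays injective for test modules in an arbitrary universe is
proved in `LinearMap.IsCrisp.rTensor_injective`; see also `LinearMap.isCrisp_iff`. -/
def LinearMap.IsCrisp {A : Type u} [CommRing A] {M : Type v} {N : Type w}
    [AddCommGroup M] [Module A M] [AddCommGroup N] [Module A N] (f : M →ₗ[A] N) : Prop :=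
  ∀ (P : Type u) [AddCommGroup P] [Module A P], Function.Injective (f.rTensor P)

/-- A homomorphism of commutative rings `A → B` (given as an `A`-algebra `B`, the homomorphism
being `algebraMap A B`) is *crisp* if it is crisp as an `A`-linear map. -/
def Algebra.IsCrisp (A : Type u) (B : Type v) [CommRing A] [CommRing B] [Algebra A B] : Prop :=
  (Algebra.linearMap A B).IsCrisp

section UniverseIndependence

/-- A crisp map stays injective after tensoring with a module in an arbitrary universe. -/
theorem LinearMap.IsCrisp.rTensor_injective {A : Type u} [CommRing A] {M : Type v} {N : Type w}
    [AddCommGroup M] [Module A M] [AddCommGroup N] [Module A N] {f : M →ₗ[A] N} (hf : f.IsCrisp)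
    (P : Type*) [AddCommGroup P] [Module A P] : Function.Injective (f.rTensor P) := by
  rw [← LinearMap.lTensor_inj_iff_rTensor_inj]
  have key : ∀ Q : Submodule A P, Q.FG → Function.Injective (f.lTensor Q) := by
    intro Q hQ
    have : Small.{u} Q := Submodule.FG.small Q hQ
    rw [LinearMap.lTensor_inj_iff_rTensor_inj]
    let e : Shrink.{u} Q ≃ₗ[A] Q := Shrink.linearEquiv A Q
    have h1 := hf (Shrink.{u} Q)
    have hcomm : f.rTensor Q ∘ₗ (e.lTensor M).toLinearMap
        = (e.lTensor N).toLinearMap ∘ₗ f.rTensor (Shrink.{u} Q) := by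
      ext x y
      simp
    have h2 : Function.Injective (f.rTensor Q ∘ₗ (e.lTensor M).toLinearMap) := by
      rw [hcomm]
      exact (e.lTensor N).injective.comp h1
    intro x y hxy
    obtain ⟨x', rfl⟩ := (e.lTensor M).surjective x
    obtain ⟨y', rfl⟩ := (e.lTensor M).surjective y
    exact congrArg _ (h2 hxy)
  rw [injective_iff_map_eq_zero]
  intro t ht
  obtain ⟨Q, hQ, s, rfl⟩ := TensorProduct.exists_of_fg t
  have h0 : Q.subtype.rTensor N (f.lTensor Q s) = 0 := by
    rw [← ht]
    simp only [← LinearMap.comp_apply, LinearMap.rTensor_comp_lTensor,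
      LinearMap.lTensor_comp_rTensor]
  obtain ⟨Q', hle, hQ', h⟩ := TensorProduct.eq_zero_of_fg_of_subtype_eq_zero hQ h0
  have h1 : f.lTensor Q' ((Submodule.inclusion hle).rTensor M s) = 0 := by
    rw [← h]
    simp only [← LinearMap.comp_apply, LinearMap.rTensor_comp_lTensor,
      LinearMap.lTensor_comp_rTensor]
  have h2 := (injective_iff_map_eq_zero _).mp (key Q' hQ') _ h1
  rw [← Submodule.subtype_comp_inclusion _ _ hle, LinearMap.rTensor_comp, LinearMap.comp_apply, h2,
    map_zero]

/-- The definition of crispness does not depend on the universe of the test modules, as long as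
that universe contains (copies of) the modules in the universe of `A`. -/
theorem LinearMap.isCrisp_iff {A : Type u} [CommRing A] {M : Type v} {N : Type w}
    [AddCommGroup M] [Module A M] [AddCommGroup N] [Module A N] {f : M →ₗ[A] N} :
    f.IsCrisp ↔ ∀ (P : Type (max u v w)) [AddCommGroup P] [Module A P],
      Function.Injective (f.rTensor P) := by
  refine ⟨fun hf P _ _ => hf.rTensor_injective P, fun h P _ _ => ?_⟩
  let e : ULift.{max v w} P ≃ₗ[A] P := ULift.moduleEquiv
  have hcomm : f.rTensor P ∘ₗ (e.lTensor M).toLinearMap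
      = (e.lTensor N).toLinearMap ∘ₗ f.rTensor (ULift.{max v w} P) := by
    ext x y
    simp
  have h2 : Function.Injective (f.rTensor P ∘ₗ (e.lTensor M).toLinearMap) := by
    rw [hcomm]
    exact (e.lTensor N).injective.comp (h _)
  intro x y hxy
  obtain ⟨x', rfl⟩ := (e.lTensor M).surjective x
  obtain ⟨y', rfl⟩ := (e.lTensor M).surjective y
  exact congrArg _ (h2 hxy)

end UniverseIndependence

/-! Integrality of `r` means that for some `n` the power `r ^ n` lies in the `A`-span `N` of the
lower powers. A monic equation for `r ⊗ 1` over `B` puts `r ^ n ⊗ 1` in the image of `N ⊗ B`.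
Crispness, tested on the quotient `R ⧸ N`, brings this membership back to `A`, although the
coefficients of the equation need not come from `A`. -/

/-- If `A → B` is crisp, then membership in a submodule `N` of `M` can be tested after tensoring
with `B`. -/
theorem Algebra.IsCrisp.mem_of_tmul_one_mem_range {A : Type u} {B : Type v} {M : Type w}
    [CommRing A] [CommRing B] [Algebra A B] [AddCommGroup M] [Module A M]
    (hB : Algebra.IsCrisp A B) (N : Submodule A M) {x : M}
    (hx : x ⊗ₜ[A] (1 : B) ∈ LinearMap.range (N.subtype.rTensor B)) : x ∈ N := by
  obtain ⟨t, ht⟩ := hx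
  have h0 : N.mkQ x ⊗ₜ[A] (1 : B) = 0 := by
    have h : N.mkQ ∘ₗ N.subtype = 0 := by ext y; simp
    rw [← LinearMap.rTensor_tmul, ← ht, ← LinearMap.comp_apply, ← LinearMap.rTensor_comp, h,
      LinearMap.rTensor_zero, LinearMap.zero_apply]
  -- Crispness with test module `M ⧸ N`: the map `A ⊗ (M ⧸ N) → B ⊗ (M ⧸ N)` is injective and sends
  -- this element to the swap of the one killed in `h0`.
  have h1 : (1 : A) ⊗ₜ[A] N.mkQ x = (0 : A ⊗[A] (M ⧸ N)) := by
    apply LinearMap.IsCrisp.rTensor_injective hB (M ⧸ N)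
    rw [map_zero, LinearMap.rTensor_tmul, Algebra.linearMap_apply, map_one,
      ← _root_.TensorProduct.comm_tmul A, h0, map_zero]
  have h2 : _root_.TensorProduct.lid A (M ⧸ N) ((1 : A) ⊗ₜ[A] N.mkQ x) = 0 := by rw [h1, map_zero]
  rw [_root_.TensorProduct.lid_tmul, one_smul] at h2
  exact (Submodule.Quotient.mk_eq_zero N).mp h2

/-- An element `r` is integral as soon as some power `r ^ n` is the value at `r` of a polynomial of
degree less than `n`. -/
theorem IsIntegral.of_pow_mem_map_degreeLT {A : Type u} {R : Type w} [CommRing A] [CommRing R]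
    [Algebra A R] {r : R} {n : ℕ}
    (h : r ^ n ∈ (Polynomial.degreeLT A n).map (Polynomial.aeval r).toLinearMap) :
    IsIntegral A r := by
  obtain ⟨q, hq, hqr⟩ := h
  refine ⟨Polynomial.X ^ n - q, Polynomial.monic_X_pow_sub ?_, ?_⟩
  · exact Polynomial.mem_degreeLT.mp hq
  · rw [← Polynomial.aeval_def, map_sub, map_pow, Polynomial.aeval_X, sub_eq_zero]
    exact hqr.symm

theorem proposition1p10 {A : Type u} {B : Type v} {R : Type w}
    [CommRing A] [CommRing B] [CommRing R] [Algebra A B] [Algebra A R]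
    (hB : Algebra.IsCrisp A B)
    (hR : (Algebra.TensorProduct.includeRight : B →ₐ[A] R ⊗[A] B).toRingHom.IsIntegral) :
    Algebra.IsIntegral A R := by
  refine ⟨fun r => ?_⟩
  obtain ⟨p, hp, hpr⟩ := hR (r ⊗ₜ[A] 1)
  refine IsIntegral.of_pow_mem_map_degreeLT (n := p.natDegree)
    (hB.mem_of_tmul_one_mem_range _ ?_)
  rw [Polynomial.eval₂_eq_sum_range, Finset.sum_range_succ, hp.coeff_natDegree, map_one, one_mul,
    Algebra.TensorProduct.tmul_pow, one_pow] at hpr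
  rw [eq_neg_of_add_eq_zero_right hpr]
  refine neg_mem (sum_mem fun i hi => ?_)
  have hmem : r ^ i ∈ (Polynomial.degreeLT A p.natDegree).map (Polynomial.aeval r).toLinearMap :=
    ⟨Polynomial.X ^ i, Polynomial.mem_degreeLT.mpr ((Polynomial.degree_X_pow_le i).trans_lt
      (by exact_mod_cast Finset.mem_range.mp hi)), by simp⟩
  -- The coefficient from `B` is absorbed by the right factor: `(1 ⊗ b) * (r ^ i ⊗ 1) = r ^ i ⊗ b`.
  exact ⟨⟨r ^ i, hmem⟩ ⊗ₜ[A] p.coeff i, by simp⟩
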